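/- Let $X$ be a real or complex Banach space with an unconditional basis $(e_i)_{i\in\mathbb N}$. A block-sequence of $(e_i)$ is an infinite sequence $(y_n)_{n\in\mathbb N}$ of nonzero vectors of $X$, each with finite support with respect to $(e_i)$, such that $\max \operatorname{supp}(y_n)<\min\operatorname{supp}(y_{n+1})$ for all $n$; a block-subspace of $X$ is the closed linear span of a block-sequence. A closed subspace $Y$ of $X$ is complemented if there is a bounded linear projection of $X$ onto $Y$, and $C$-complemented if there is such a projection of norm at most $C$. Suppose that every block-subspace of $X$ is complemented in $X$. Then there exists a constant $C>0$ such that every block-subspace of $X$ is $C$-complemented in $X$. -/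

import Mathlib

namespace BlockSubspaces

variable {𝕜 : Type*} [RCLike 𝕜] {X : Type*} [NormedAddCommGroup X] [NormedSpace 𝕜 X]

/-- The support of a vector with respect to the basis `e`: the set of indices of its nonzero
coordinates. -/
def support (e : UnconditionalSchauderBasis ℕ 𝕜 X) (x : X) : Set ℕ :=
  {i | e.coord i x ≠ 0}

/-- An (infinite) block-sequence of the basis `e`: a sequence of nonzero, finitely supported
vectors whose supports are successive. -/
structure IsBlockSequence (e : UnconditionalSchauderBasis ℕ 𝕜 X) (y : ℕ → X) : Prop where
  ne_zero : ∀ n, y n ≠ 0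
  finite_support : ∀ n, (support e (y n)).Finite
  support_lt : ∀ n, ∀ i ∈ support e (y n), ∀ j ∈ support e (y (n + 1)), i < j

/-- A block-subspace: the closed linear span of a block-sequence. -/
def IsBlockSubspace (e : UnconditionalSchauderBasis ℕ 𝕜 X) (Y : Submodule 𝕜 X) : Prop :=
  ∃ y : ℕ → X, IsBlockSequence e y ∧ Y = (Submodule.span 𝕜 (Set.range y)).topologicalClosure

/-- `Y` is `C`-complemented: there is a continuous linear projection of the whole space onto `Y`
of norm at most `C`. -/
def IsComplementedWith (C : ℝ) (Y : Submodule 𝕜 X) : Prop :=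
  ∃ P : X →L[𝕜] Y, (∀ x : Y, P x = x) ∧ ‖P‖ ≤ C

end BlockSubspaces

/-! Gliding hump. For finite families `DiagComplemented` asks for a projection acting block by
block, with all partial sums bounded by a common constant. If a disjoint family spans a complemented
subspace, averaging its projection over signs removes the off-diagonal terms, so all finite
subfamilies are diagonally complemented with one constant (`exists_diagComplemented`). Conversely,
an ultrafilter limit turns a uniform constant on finite subfamilies into a projection of that norm
onto the closed span (`isComplementedWith`). Without a uniform constant, there are thus finite block
families of arbitrarily bad constant. Dropping the few early blocks costs a bounded amount, so they
occur arbitrarily far out (`exists_not_diagComplemented`) and can be concatenated into a single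
block-sequence, whose complemented span contradicts the first implication. -/

open Filter Topology

namespace BlockSubspaces

section

variable {𝕜 : Type*} [RCLike 𝕜] {X : Type*} [NormedAddCommGroup X] [NormedSpace 𝕜 X]

/-! ### Disjoint families and block projections -/

open scoped Classical in
/-- The support of a finitely supported vector as a finset (and `∅` for other vectors). -/
noncomputable def suppFinset (e : UnconditionalSchauderBasis ℕ 𝕜 X) (v : X) : Finset ℕ :=
  if h : (support e v).Finite then h.toFinset else ∅

/-- The basis projection onto the support of a finitely supported vector. -/
noncomputable def blockProj (e : UnconditionalSchauderBasis ℕ 𝕜 X) (v : X) : X →L[𝕜] X :=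
  e.proj (suppFinset e v)

/-- A set of nonzero finitely supported vectors with pairwise disjoint supports. -/
structure IsDisjointFamily (e : UnconditionalSchauderBasis ℕ 𝕜 X) (S : Set X) : Prop where
  ne_zero : ∀ v ∈ S, v ≠ 0
  finite_support : ∀ v ∈ S, (support e v).Finite
  disjoint : ∀ v ∈ S, ∀ w ∈ S, v ≠ w → Disjoint (support e v) (support e w)

/-- There is a projection of the form `x ↦ ∑ v ∈ s, f v (x restricted to the support of v) • v`
onto the span of `s`, such that it and its partial sums are bounded by `C`. -/
def DiagComplemented (e : UnconditionalSchauderBasis ℕ 𝕜 X) (s : Finset X) (C : ℝ) : Prop :=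
  ∃ f : X → StrongDual 𝕜 X, (∀ v ∈ s, f v v = 1) ∧
    ∀ t ⊆ s, ∀ x, ‖∑ v ∈ t, f v (blockProj e v x) • v‖ ≤ C * ‖x‖

variable {e : UnconditionalSchauderBasis ℕ 𝕜 X}

theorem mem_suppFinset {v : X} (hv : (support e v).Finite) {i : ℕ} :
    i ∈ suppFinset e v ↔ i ∈ support e v := by
  simp [suppFinset, hv]

theorem support_nonempty {v : X} (hv : v ≠ 0) : (support e v).Nonempty := by
  by_contra h
  rw [Set.not_nonempty_iff_eq_empty] at h
  have h0 : ∀ i, e.coord i v = 0 := fun i => by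
    by_contra hi
    exact (h ▸ (show i ∈ support e v from hi) : i ∈ (∅ : Set ℕ))
  have := e.expansion v
  simp only [h0, zero_smul] at this
  exact hv (this.unique hasSum_zero)

theorem blockProj_self {v : X} (hv : (support e v).Finite) : blockProj e v v = v := by
  rw [blockProj, GeneralSchauderBasis.proj_apply]
  refine HasSum.unique (hasSum_sum_of_ne_finset_zero fun i hi => ?_) (e.expansion v)
  rw [mem_suppFinset hv] at hi
  have : e.coord i v = 0 := by simpa [support] using hi
  simp [this]

theorem blockProj_of_disjoint {v w : X} (hv : (support e v).Finite)
    (h : Disjoint (support e v) (support e w)) : blockProj e v w = 0 := by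
  rw [blockProj, GeneralSchauderBasis.proj_apply]
  refine Finset.sum_eq_zero fun i hi => ?_
  have : e.coord i w = 0 := by
    by_contra hw
    exact Set.disjoint_left.1 h ((mem_suppFinset hv).1 hi) hw
  simp [this]

namespace IsDisjointFamily

variable {S : Set X}

theorem disjoint_suppFinset (hS : IsDisjointFamily e S) {v w : X} (hv : v ∈ S) (hw : w ∈ S)
    (h : v ≠ w) : Disjoint (suppFinset e v) (suppFinset e w) :=
  Finset.disjoint_left.2 fun _ hi hj => Set.disjoint_left.1 (hS.disjoint v hv w hw h)
    ((mem_suppFinset (hS.finite_support v hv)).1 hi)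
    ((mem_suppFinset (hS.finite_support w hw)).1 hj)

theorem sum_blockProj (hS : IsDisjointFamily e S) {t : Finset X} (ht : ↑t ⊆ S) (x : X) :
    ∑ v ∈ t, blockProj e v x = e.proj (t.biUnion (suppFinset e)) x := by
  simp only [blockProj, GeneralSchauderBasis.proj_apply]
  rw [Finset.sum_biUnion]
  exact fun v hv w hw h => hS.disjoint_suppFinset (ht hv) (ht hw) h

theorem blockProj_eq (hS : IsDisjointFamily e S) {v w : X} (hv : v ∈ S) (hw : w ∈ S) :
    blockProj e v w = open scoped Classical in if v = w then v else 0 := by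
  split_ifs with h
  · rw [← h, blockProj_self (hS.finite_support v hv)]
  · exact blockProj_of_disjoint (hS.finite_support v hv) (hS.disjoint v hv w hw h)

end IsDisjointFamily

/-! ### From a projection to diagonal projections -/

/-- The diagonal is the average over all signs. The induction averages one sign at a time, with `u`
absorbing the diagonal terms already isolated. -/
theorem norm_add_sum_diag_le {ι : Type*} (s : Finset ι) (a : ι → ι → X) (M : ℝ) (u : X)
    (H : ∀ ε : ι → 𝕜, (∀ n, ε n = 1 ∨ ε n = -1) →
      ‖u + ∑ n ∈ s, ∑ k ∈ s, (ε n * ε k) • a n k‖ ≤ M) :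
    ‖u + ∑ n ∈ s, a n n‖ ≤ M := by
  classical
  induction s using Finset.induction_on generalizing u with
  | empty => simpa using H 1 (by simp)
  | insert j s hj ih =>
    rw [Finset.sum_insert hj, ← add_assoc]
    refine ih _ fun ε hε => ?_
    -- The sign `c` at `j` enters only linearly, as `c * c = 1`; averaging `c = 1` and `c = -1`
    -- cancels row and column `j` off the diagonal.
    have key : ∀ c : 𝕜, (c = 1 ∨ c = -1) →
        ‖(u + a j j + ∑ n ∈ s, ∑ k ∈ s, (ε n * ε k) • a n k) +
          c • (∑ k ∈ s, ε k • a j k + ∑ n ∈ s, ε n • a n j)‖ ≤ M := by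
      intro c hc
      have h1 := H (Function.update ε j c) fun n => by
        rcases eq_or_ne n j with rfl | h
        · simpa using hc
        · simpa [h] using hε n
      have hn : ∀ n ∈ s, Function.update ε j c n = ε n := fun n hn =>
        Function.update_of_ne (ne_of_mem_of_not_mem hn hj) _ _
      have hcc : c * c = 1 := by rcases hc with rfl | rfl <;> simp
      convert h1 using 2
      rw [Finset.sum_insert hj, Finset.sum_insert hj]
      have e1 : ∑ n ∈ s, ∑ k ∈ insert j s,
          (Function.update ε j c n * Function.update ε j c k) • a n k =
          ∑ n ∈ s, ((c • ε n • a n j) + ∑ k ∈ s, (ε n * ε k) • a n k) := by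
        refine Finset.sum_congr rfl fun n hns => ?_
        rw [Finset.sum_insert hj, hn n hns, Function.update_self, smul_smul, mul_comm c]
        congr 1
        exact Finset.sum_congr rfl fun k hk => by rw [hn k hk]
      have e2 : ∑ k ∈ s, (Function.update ε j c j * Function.update ε j c k) • a j k =
          ∑ k ∈ s, c • ε k • a j k :=
        Finset.sum_congr rfl fun k hk => by rw [hn k hk, Function.update_self, smul_smul]
      rw [e1, e2, Function.update_self, hcc, one_smul, Finset.sum_add_distrib,
        ← Finset.smul_sum, ← Finset.smul_sum, smul_add]
      abel
    have h1 := key 1 (Or.inl rfl)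
    have h2 := key (-1) (Or.inr rfl)
    set w := u + a j j + ∑ n ∈ s, ∑ k ∈ s, (ε n * ε k) • a n k
    set d := ∑ k ∈ s, ε k • a j k + ∑ n ∈ s, ε n • a n j
    have h3 : ‖(2 : 𝕜) • w‖ ≤ M + M := by
      have : (2 : 𝕜) • w = (w + (1 : 𝕜) • d) + (w + (-1 : 𝕜) • d) := by
        rw [one_smul, neg_one_smul, two_smul]; abel
      rw [this]
      exact norm_add_le_of_le h1 h2
    rw [norm_smul, RCLike.norm_ofNat] at h3
    linarith

/-- The signed sum is a difference of two basis projections, one per sign. -/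
theorem IsDisjointFamily.norm_sum_sign_smul_blockProj_le {S : Set X} (hS : IsDisjointFamily e S)
    {K : ℝ} (hK : ∀ A, ‖e.proj A‖ ≤ K) {t : Finset X} (ht : ↑t ⊆ S) {ε : X → 𝕜}
    (hε : ∀ v, ε v = 1 ∨ ε v = -1) (x : X) :
    ‖∑ v ∈ t, ε v • blockProj e v x‖ ≤ 2 * K * ‖x‖ := by
  classical
  have h1 : ∀ t' ⊆ t, ‖∑ v ∈ t', blockProj e v x‖ ≤ K * ‖x‖ := fun t' h => by
    rw [hS.sum_blockProj (fun v hv => ht (h hv))]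
    exact (e.proj _).le_of_opNorm_le (hK _) x
  have h2 : ∑ v ∈ t, ε v • blockProj e v x =
      ∑ v ∈ t with ε v = 1, blockProj e v x - ∑ v ∈ t with ¬ ε v = 1, blockProj e v x := by
    rw [← Finset.sum_filter_add_sum_filter_not t (fun v => ε v = 1), sub_eq_add_neg,
      ← Finset.sum_neg_distrib]
    congr 1
    · exact Finset.sum_congr rfl fun v hv => by rw [(Finset.mem_filter.1 hv).2, one_smul]
    · refine Finset.sum_congr rfl fun v hv => ?_
      rw [(hε v).resolve_left (Finset.mem_filter.1 hv).2, neg_one_smul]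
  rw [h2]
  refine (norm_sub_le_of_le (h1 _ (Finset.filter_subset _ _))
    (h1 _ (Finset.filter_subset _ _))).trans_eq ?_
  ring

theorem exists_dual_eq_one {v : X} (hv : v ≠ 0) :
    ∃ g : StrongDual 𝕜 X, g v = 1 ∧ ‖g‖ = ‖v‖⁻¹ := by
  obtain ⟨g, hg, hgv⟩ := exists_dual_vector 𝕜 v (norm_ne_zero_iff.2 hv)
  refine ⟨((‖v‖ : 𝕜)⁻¹) • g, ?_, ?_⟩
  · have : (‖v‖ : 𝕜) ≠ 0 := by simpa using hv
    simp [hgv, this]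
  · simp [norm_smul, hg]

/-- A projection onto the closed span of a disjoint family yields uniformly bounded diagonal
projections onto the spans of its finite subsets. -/
theorem IsDisjointFamily.exists_diagComplemented {S : Set X} (hS : IsDisjointFamily e S)
    {K : ℝ} (hK : ∀ A, ‖e.proj A‖ ≤ K)
    (hc : (Submodule.span 𝕜 S).topologicalClosure.ClosedComplemented) :
    ∃ C, ∀ s : Finset X, ↑s ⊆ S → DiagComplemented e s C := by
  classical
  set Y := (Submodule.span 𝕜 S).topologicalClosure
  obtain ⟨P₀, hP₀⟩ := hc
  set P : X →L[𝕜] X := Y.subtypeL ∘L P₀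
  have hSY : S ⊆ Y := Submodule.subset_span.trans (Submodule.le_topologicalClosure _)
  have hPv : ∀ v ∈ S, P v = v := fun v hv =>
    congrArg Subtype.val (hP₀ ⟨v, hSY hv⟩)
  have hg : ∀ v : X, ∃ g : StrongDual 𝕜 X, v ∈ S → g v = 1 := fun v => by
    by_cases hv : v ∈ S
    · obtain ⟨g, hg, -⟩ := exists_dual_eq_one (𝕜 := 𝕜) (hS.ne_zero v hv)
      exact ⟨g, fun _ => hg⟩
    · exact ⟨0, fun h => (hv h).elim⟩
  choose g hg using hg
  have hproj : ∀ v ∈ S, ∀ z ∈ Y, blockProj e v z = g v (blockProj e v z) • v := by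
    intro v hv z hz
    have hcl : IsClosed {z : X | blockProj e v z = g v (blockProj e v z) • v} :=
      isClosed_eq (by fun_prop) (by fun_prop)
    refine closure_minimal (fun z hz => ?_) hcl hz
    induction hz using Submodule.span_induction with
    | mem w hw =>
      simp only [Set.mem_ofPred_eq, hS.blockProj_eq hv hw]
      split_ifs <;> simp [hg v hv]
    | zero => simp
    | add a b _ _ ha hb =>
      simp only [Set.mem_ofPred_eq] at ha hb ⊢
      rw [map_add, map_add, add_smul, ← ha, ← hb]
    | smul c a _ ha =>
      simp only [Set.mem_ofPred_eq] at ha ⊢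
      rw [map_smul, map_smul, smul_assoc, ← ha]
  -- One factor `2 * K` for the signs on each side of `P`.
  refine ⟨2 * K * (‖P‖ * (2 * K)), fun s hs => ⟨fun v => g v ∘L blockProj e v ∘L P,
    fun v hv => ?_, fun t ht x => ?_⟩⟩
  · simp [hPv v (hs hv), blockProj_self (hS.finite_support v (hs hv)), hg v (hs hv)]
  · have hK0 : 0 ≤ K := (norm_nonneg _).trans (hK ∅)
    have htS : ↑t ⊆ S := fun v hv => hs (ht hv)
    have := norm_add_sum_diag_le (𝕜 := 𝕜) t
      (fun v w => blockProj e v (P (blockProj e w x))) (2 * K * (‖P‖ * (2 * K)) * ‖x‖) 0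
      fun ε hε => by
        have h1 : ∑ n ∈ t, ∑ k ∈ t, (ε n * ε k) • blockProj e n (P (blockProj e k x)) =
            ∑ n ∈ t, ε n • blockProj e n (P (∑ k ∈ t, ε k • blockProj e k x)) := by
          refine Finset.sum_congr rfl fun n _ => ?_
          simp only [map_sum, map_smul, Finset.smul_sum, smul_smul]
        rw [zero_add, h1]
        refine (hS.norm_sum_sign_smul_blockProj_le hK htS hε _).trans ?_
        rw [mul_assoc (2 * K), mul_assoc ‖P‖]
        refine mul_le_mul_of_nonneg_left ?_ (by positivity)
        exact (P.le_opNorm _).trans (mul_le_mul_of_nonneg_left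
          (hS.norm_sum_sign_smul_blockProj_le hK htS hε x) (norm_nonneg _))
    rw [zero_add] at this
    refine (congrArg norm (Finset.sum_congr rfl fun v hv => ?_)).trans_le this
    exact (hproj v (htS hv) _ (P₀ (blockProj e v x)).2).symm

/-! ### Stability of diagonal complementation -/

theorem DiagComplemented.mono {s t : Finset X} {C D : ℝ} (h : DiagComplemented e s C)
    (ht : t ⊆ s) (hCD : C ≤ D) : DiagComplemented e t D := by
  obtain ⟨f, hf, hb⟩ := h
  exact ⟨f, fun v hv => hf v (ht hv), fun t' ht' x => (hb t' (ht'.trans ht) x).trans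
    (mul_le_mul_of_nonneg_right hCD (norm_nonneg x))⟩

theorem diagComplemented_empty {C : ℝ} (hC : 0 ≤ C) : DiagComplemented e ∅ C :=
  ⟨0, by simp, fun t ht x => by
    rw [Finset.subset_empty.1 ht]
    simpa using mul_nonneg hC (norm_nonneg x)⟩

-- Overlaps are harmless: the functionals of `s` take precedence, and what remains of `t` is a
-- partial sum, still bounded by `D`.
open scoped Classical in
theorem DiagComplemented.union {s t : Finset X} {C D : ℝ} (h : DiagComplemented e s C)
    (h' : DiagComplemented e t D) : DiagComplemented e (s ∪ t) (C + D) := by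
  obtain ⟨f, hf, hb⟩ := h
  obtain ⟨g, hg, hb'⟩ := h'
  refine ⟨fun v => if v ∈ s then f v else g v, fun v hv => ?_, fun r hr x => ?_⟩
  · by_cases hvs : v ∈ s
    · simp [hvs, hf v hvs]
    · simp [hvs, hg v ((Finset.mem_union.1 hv).resolve_left hvs)]
  · rw [← Finset.sum_filter_add_sum_filter_not r (fun v => v ∈ s), add_mul]
    refine norm_add_le_of_le ?_ ?_
    · refine (congrArg norm (Finset.sum_congr rfl fun v hv => ?_)).trans_le
        (hb (r.filter (· ∈ s)) (fun v hv => (Finset.mem_filter.1 hv).2) x)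
      simp only [if_pos (Finset.mem_filter.1 hv).2]
    · refine (congrArg norm (Finset.sum_congr rfl fun v hv => ?_)).trans_le
        (hb' (r.filter (¬ · ∈ s)) (fun v hv => ?_) x)
      · simp only [if_neg (Finset.mem_filter.1 hv).2]
      · rw [Finset.mem_filter] at hv
        exact (Finset.mem_union.1 (hr hv.1)).resolve_left hv.2

theorem diagComplemented_singleton {K : ℝ} (hK : ∀ A, ‖e.proj A‖ ≤ K) {v : X} (hv : v ≠ 0) :
    DiagComplemented e {v} K := by
  obtain ⟨g, hg, hgn⟩ := exists_dual_eq_one (𝕜 := 𝕜) hv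
  have hK0 : 0 ≤ K := (norm_nonneg _).trans (hK ∅)
  refine ⟨fun _ => g, fun w hw => by rw [Finset.mem_singleton.1 hw, hg], fun t ht x => ?_⟩
  rcases Finset.subset_singleton_iff.1 ht with rfl | rfl
  · simpa using mul_nonneg hK0 (norm_nonneg x)
  · rw [Finset.sum_singleton, norm_smul]
    have h1 : ‖g (blockProj e v x)‖ ≤ ‖v‖⁻¹ * (K * ‖x‖) :=
      (g.le_opNorm _).trans (by
        rw [hgn]
        exact mul_le_mul_of_nonneg_left ((e.proj _).le_of_opNorm_le (hK _) x) (by positivity))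
    have hv' : 0 < ‖v‖ := norm_pos_iff.2 hv
    calc _ ≤ ‖v‖⁻¹ * (K * ‖x‖) * ‖v‖ := mul_le_mul_of_nonneg_right h1 hv'.le
      _ = K * ‖x‖ := by field_simp

theorem diagComplemented_card {K : ℝ} (hK : ∀ A, ‖e.proj A‖ ≤ K) {s : Finset X}
    (hs : ∀ v ∈ s, v ≠ 0) : DiagComplemented e s (s.card * K) := by
  classical
  induction s using Finset.induction_on with
  | empty => exact diagComplemented_empty (by simp)
  | insert v s hv ih =>
    rw [Finset.card_insert_of_notMem hv, Finset.insert_eq]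
    refine ((diagComplemented_singleton hK (hs v (by simp))).union
      (ih fun w hw => hs w (by simp [hw]))).mono subset_rfl (le_of_eq ?_)
    push_cast
    ring

/-! ### From finite subfamilies to the closed span -/

theorem exists_tendsto_of_eventually_norm_le {α : Type*} (u : Ultrafilter α) {φ : α → 𝕜} {R : ℝ}
    (h : ∀ᶠ a in u, ‖φ a‖ ≤ R) : ∃ L, Tendsto φ u (𝓝 L) := by
  obtain ⟨L, -, hL⟩ := (isCompact_closedBall (0 : 𝕜) R).ultrafilter_le_nhds' (u.map φ)
    (h.mono fun a ha => by simpa using ha)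
  exact ⟨L, hL⟩

theorem coord_proj {A : Finset ℕ} {i : ℕ} (hi : i ∈ A) (x : X) :
    e.coord i (e.proj A x) = e.coord i x := by
  simp [e.ortho, Pi.single_apply, hi]

theorem IsDisjointFamily.finite_meet {S : Set X} (hS : IsDisjointFamily e S) (B : Finset ℕ) :
    {v : S | ¬ Disjoint (suppFinset e v.1) B}.Finite := by
  have : {v : S | ¬ Disjoint (suppFinset e v.1) B} ⊆
      ⋃ i ∈ (B : Set ℕ), {v : S | i ∈ suppFinset e v.1} := fun v hv => by
    obtain ⟨i, hi, hiB⟩ := Finset.not_disjoint_iff.1 hv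
    exact Set.mem_biUnion (Finset.mem_coe.2 hiB) hi
  refine Set.Finite.subset (B.finite_toSet.biUnion fun i _ => ?_) this
  refine Set.Subsingleton.finite fun v hv w hw => ?_
  by_contra h
  exact Finset.disjoint_left.1
    (hS.disjoint_suppFinset v.2 w.2 fun h' => h (Subtype.ext h')) hv hw

/-- Uniformly bounded diagonal projections onto the spans of finite subsets have a limit
point whose functionals are biorthogonal and define uniformly bounded partial sums. -/
theorem IsDisjointFamily.exists_limit_functionals {S : Set X} (hS : IsDisjointFamily e S)
    {C : ℝ} (H : ∀ s : Finset X, ↑s ⊆ S → DiagComplemented e s C) :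
    ∃ F : S → StrongDual 𝕜 X, (∀ v, F v v = 1) ∧ (∀ v w : S, v ≠ w → F v w = 0) ∧
      (∀ v A x, suppFinset e v.1 ⊆ A → F v (e.proj A x) = F v x) ∧
      ∀ (t : Finset S) x, ‖∑ v ∈ t, F v x • (v : X)‖ ≤ C * ‖x‖ := by
  classical
  have H' : ∀ σ : Finset S, ∃ f : S → StrongDual 𝕜 X, (∀ v ∈ σ, f v v = 1) ∧
      ∀ t ⊆ σ, ∀ x, ‖∑ v ∈ t, f v (blockProj e v.1 x) • (v : X)‖ ≤ C * ‖x‖ := fun σ => by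
    obtain ⟨f, hf, hb⟩ := H (σ.map (Function.Embedding.subtype _)) (by
      intro v hv
      simp only [Finset.coe_map, Set.mem_image] at hv
      obtain ⟨w, -, rfl⟩ := hv
      exact w.2)
    refine ⟨fun v => f v, fun v hv => hf v (Finset.mem_map_of_mem _ hv), fun t ht x => ?_⟩
    simpa using hb (t.map (Function.Embedding.subtype _)) (Finset.map_subset_map.2 ht) x
  choose f hf hb using H'
  let u : Ultrafilter (Finset S) := Ultrafilter.of atTop
  have hu : (u : Filter (Finset S)) ≤ atTop := Ultrafilter.of_le atTop
  have hsub : ∀ t : Finset S, ∀ᶠ σ in (u : Filter (Finset S)), t ⊆ σ := fun t =>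
    hu (eventually_ge_atTop t)
  -- Only the values at the finitely many `e i` in the support of `v` matter; the partial sum over
  -- `{v}` bounds them.
  have hlim : ∀ (v : S) (i : ℕ), ∃ L, i ∈ suppFinset e v.1 →
      Tendsto (fun σ => f σ v (e i)) u (𝓝 L) := fun v i => by
    by_cases hi : i ∈ suppFinset e v.1
    · have hv : 0 < ‖(v : X)‖ := norm_pos_iff.2 (hS.ne_zero v v.2)
      obtain ⟨L, hL⟩ := exists_tendsto_of_eventually_norm_le u (φ := fun σ => f σ v (e i))
        (R := C * ‖e i‖ / ‖(v : X)‖) ((hsub {v}).mono fun σ hσ => by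
          have h1 := hb σ {v} hσ (e i)
          have h2 : blockProj e v.1 (e i) = e i := by
            rw [blockProj, GeneralSchauderBasis.proj_apply_basis_mem, if_pos hi]
          rw [Finset.sum_singleton, h2, norm_smul] at h1
          rwa [le_div_iff₀ hv])
      exact ⟨L, fun _ => hL⟩
    · exact ⟨0, fun h => (hi h).elim⟩
  choose L hL using hlim
  have hLF : ∀ (v : S) x, Tendsto (fun σ => f σ v (blockProj e v.1 x)) u
      (𝓝 ((∑ i ∈ suppFinset e v.1, L v i • e.coord i : StrongDual 𝕜 X) x)) := fun v x => by
    simp only [blockProj, GeneralSchauderBasis.proj_apply, map_sum, map_smul, smul_eq_mul,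
      sum_apply, smul_apply]
    refine tendsto_finsetSum _ fun i hi => ?_
    rw [mul_comm (L v i)]
    exact (hL v i hi).const_mul _
  refine ⟨fun v => ∑ i ∈ suppFinset e v.1, L v i • e.coord i, fun v => ?_, fun v w hvw => ?_,
    fun v A x hA => ?_, fun t x => ?_⟩
  · have := hLF v v
    rw [blockProj_self (hS.finite_support v v.2)] at this
    exact tendsto_nhds_unique this (tendsto_const_nhds.congr' ((hsub {v}).mono fun σ hσ =>
      (hf σ v (Finset.singleton_subset_iff.1 hσ)).symm))
  · have := hLF v w
    rw [hS.blockProj_eq v.2 w.2, if_neg fun h => hvw (Subtype.ext h)] at this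
    simp only [map_zero] at this
    exact tendsto_nhds_unique this tendsto_const_nhds
  · simp only [sum_apply, smul_apply]
    exact Finset.sum_congr rfl fun i hi => by rw [coord_proj (hA hi)]
  · have h1 : Tendsto (fun σ => ‖∑ v ∈ t, f σ v (blockProj e v.1 x) • (v : X)‖) u
        (𝓝 ‖∑ v ∈ t, (∑ i ∈ suppFinset e v.1, L v i • e.coord i : StrongDual 𝕜 X) x •
          (v : X)‖) :=
      (tendsto_finsetSum _ fun v _ => (hLF v x).smul_const _).norm
    exact le_of_tendsto h1 ((hsub t).mono fun σ hσ => hb σ t hσ x)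

/-- The limit functional of `v` sees only coordinates in the support of `v`, so tails of the series
are controlled by tails of the unconditional expansion of `x`. -/
theorem IsDisjointFamily.isComplementedWith [CompleteSpace X] {S : Set X}
    (hS : IsDisjointFamily e S) {C : ℝ} (hC : 0 ≤ C)
    (H : ∀ s : Finset X, ↑s ⊆ S → DiagComplemented e s C) :
    IsComplementedWith C (Submodule.span 𝕜 S).topologicalClosure := by
  classical
  obtain ⟨F, hF1, hF0, hFA, hFb⟩ := hS.exists_limit_functionals H
  have hsum : ∀ x, Summable fun v : S => F v x • (v : X) := fun x => by
    rw [summable_iff_vanishing_norm]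
    intro δ hδ
    obtain ⟨B, hB⟩ := summable_iff_vanishing_norm.1 (e.expansion x).summable (δ / (C + 1))
      (by positivity)
    refine ⟨(hS.finite_meet B).toFinset, fun t ht => ?_⟩
    set A := t.biUnion fun v => suppFinset e v.1
    have h1 : ∑ v ∈ t, F v x • (v : X) = ∑ v ∈ t, F v (e.proj A x) • (v : X) :=
      Finset.sum_congr rfl fun v hv => by
        rw [hFA v A x (Finset.subset_biUnion_of_mem (fun v : S => suppFinset e v.1) hv)]
    have h2 : ‖e.proj A x‖ < δ / (C + 1) := by
      rw [GeneralSchauderBasis.proj_apply]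
      refine hB A ((Finset.disjoint_biUnion_left _ _ _).2 fun v hv => ?_)
      by_contra h
      exact Finset.disjoint_left.1 ht hv ((hS.finite_meet B).mem_toFinset.2 h)
    rw [h1]
    calc _ ≤ C * ‖e.proj A x‖ := hFb t _
      _ ≤ (C + 1) * ‖e.proj A x‖ :=
        mul_le_mul_of_nonneg_right (by linarith) (norm_nonneg _)
      _ < (C + 1) * (δ / (C + 1)) := by gcongr
      _ = δ := by field_simp
  let Q : X →L[𝕜] X := LinearMap.mkContinuous
    { toFun := fun x => ∑' v : S, F v x • (v : X)
      map_add' := fun x y => by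
        simp only [map_add, add_smul]
        exact (hsum x).tsum_add (hsum y)
      map_smul' := fun c x => by
        simp only [map_smul, smul_assoc, RingHom.id_apply]
        exact (hsum x).tsum_const_smul c } C fun x =>
          le_of_tendsto (hsum x).hasSum.norm (Eventually.of_forall fun t => hFb t x)
  have hQ : ∀ x, HasSum (fun v : S => F v x • (v : X)) (Q x) := fun x => (hsum x).hasSum
  have hQY : ∀ x, Q x ∈ (Submodule.span 𝕜 S).topologicalClosure := fun x =>
    (Submodule.isClosed_topologicalClosure _).mem_of_tendsto (hQ x)
      (Eventually.of_forall fun t => Submodule.sum_mem _ fun v _ => Submodule.smul_mem _ _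
        (Submodule.le_topologicalClosure _ (Submodule.subset_span v.2)))
  have hQS : Set.EqOn Q (ContinuousLinearMap.id 𝕜 X) S := fun w hw => by
    have h1 := hasSum_single (f := fun v : S => F v w • (v : X)) ⟨w, hw⟩ fun v hv => by
      simp [hF0 v ⟨w, hw⟩ hv]
    have h2 := hF1 ⟨w, hw⟩
    simp only at h1 h2
    rw [h2, one_smul] at h1
    exact (hQ w).unique h1
  refine ⟨Q.codRestrict _ hQY, fun x => Subtype.ext ?_, ?_⟩
  · exact ContinuousLinearMap.eqOn_closure_span hQS x.2
  · refine ContinuousLinearMap.opNorm_le_bound _ hC fun x => ?_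
    exact Q.le_of_opNorm_le (LinearMap.mkContinuous_norm_le _ hC _) x

/-! ### Successive families and block-sequences -/

/-- A set of nonzero finitely supported vectors, any two of which have successive supports. -/
structure IsSuccessiveFamily (e : UnconditionalSchauderBasis ℕ 𝕜 X) (S : Set X) : Prop where
  ne_zero : ∀ v ∈ S, v ≠ 0
  finite_support : ∀ v ∈ S, (support e v).Finite
  lt_or_lt : ∀ v ∈ S, ∀ w ∈ S, v ≠ w →
    (∀ i ∈ support e v, ∀ j ∈ support e w, i < j) ∨
      ∀ i ∈ support e v, ∀ j ∈ support e w, j < i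

namespace IsSuccessiveFamily

variable {S : Set X}

theorem isDisjointFamily (hS : IsSuccessiveFamily e S) : IsDisjointFamily e S :=
  ⟨hS.1, hS.2, fun v hv w hw h => Set.disjoint_left.2 fun i hi hj =>
    (hS.lt_or_lt v hv w hw h).elim (fun H => (H i hi i hj).false) fun H => (H i hi i hj).false⟩

theorem mono {T : Set X} (hS : IsSuccessiveFamily e S) (h : T ⊆ S) : IsSuccessiveFamily e T :=
  ⟨fun v hv => hS.1 v (h hv), fun v hv => hS.2 v (h hv),
    fun v hv w hw => hS.3 v (h hv) w (h hw)⟩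

/-- An infinite successive family can be enumerated as a block-sequence. -/
theorem exists_isBlockSequence (hS : IsSuccessiveFamily e S) (hinf : S.Infinite) :
    ∃ z : ℕ → X, IsBlockSequence e z ∧ Set.range z = S := by
  set m : X → ℕ := fun v => sInf (support e v)
  have hmem : ∀ v ∈ S, m v ∈ support e v := fun v hv =>
    Nat.sInf_mem (support_nonempty (hS.ne_zero v hv))
  have hinj : Set.InjOn m S := fun v hv w hw h => by
    by_contra hne
    exact Set.disjoint_left.1 (hS.isDisjointFamily.disjoint v hv w hw hne) (hmem v hv)
      (h ▸ hmem w hw)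
  have hM : (m '' S).Infinite := hinf.image hinj
  have hM' : (Set.ofPred (· ∈ m '' S)).Infinite := hM
  have hz : ∀ k, ∃ v ∈ S, m v = Nat.nth (· ∈ m '' S) k := fun k =>
    Nat.nth_mem_of_infinite hM' k
  choose z hzS hz using hz
  refine ⟨z, ⟨fun n => hS.1 _ (hzS n), fun n => hS.2 _ (hzS n), fun n => ?_⟩, ?_⟩
  · have hlt : m (z n) < m (z (n + 1)) := by
      rw [hz, hz]
      exact Nat.nth_strictMono hM' n.lt_succ_self
    refine (hS.lt_or_lt _ (hzS n) _ (hzS (n + 1)) fun h => ?_).resolve_right fun H => ?_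
    · exact hlt.ne (congrArg m h)
    · exact (H _ (hmem _ (hzS n)) _ (hmem _ (hzS (n + 1)))).not_gt hlt
  · refine Set.Subset.antisymm (Set.range_subset_iff.2 hzS) fun v hv => ?_
    have : m v ∈ Set.range (Nat.nth (· ∈ m '' S)) := by
      rw [Nat.range_nth_of_infinite hM']
      exact ⟨v, hv, rfl⟩
    obtain ⟨k, hk⟩ := this
    exact ⟨k, hinj (hzS k) hv ((hz k).trans hk)⟩

end IsSuccessiveFamily

namespace IsBlockSequence

variable {y : ℕ → X}

theorem support_lt_of_lt (hy : IsBlockSequence e y) {n m : ℕ} (h : n < m) :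
    ∀ i ∈ support e (y n), ∀ j ∈ support e (y m), i < j := by
  induction m, h using Nat.le_induction with
  | base => exact hy.support_lt n
  | succ m _ ih =>
    intro i hi j hj
    obtain ⟨k, hk⟩ := support_nonempty (e := e) (hy.ne_zero m)
    exact (ih i hi k hk).trans (hy.support_lt m k hk j hj)

theorem le_of_mem_support (hy : IsBlockSequence e y) {n i : ℕ} (hi : i ∈ support e (y n)) :
    n ≤ i := by
  induction n generalizing i with
  | zero => exact Nat.zero_le i
  | succ n ih =>
    obtain ⟨k, hk⟩ := support_nonempty (e := e) (hy.ne_zero n)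
    exact (ih hk).trans_lt (hy.support_lt n k hk i hi)

theorem isSuccessiveFamily (hy : IsBlockSequence e y) :
    IsSuccessiveFamily e (Set.range y) := by
  refine ⟨?_, ?_, ?_⟩
  · rintro _ ⟨n, rfl⟩
    exact hy.ne_zero n
  · rintro _ ⟨n, rfl⟩
    exact hy.finite_support n
  · rintro _ ⟨n, rfl⟩ _ ⟨m, rfl⟩ h
    rcases lt_trichotomy n m with hnm | rfl | hnm
    · exact Or.inl (hy.support_lt_of_lt hnm)
    · exact (h rfl).elim
    · exact Or.inr fun i hi j hj => hy.support_lt_of_lt hnm j hj i hi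

end IsBlockSequence

/-! ### Gluing bad finite families -/

/-- If the block-subspaces are not uniformly complemented, then arbitrarily badly complemented
finite block-sequences can be found arbitrarily far along the basis. -/
theorem exists_not_diagComplemented [CompleteSpace X]
    (H : ∀ C : ℝ, 0 < C → ∃ Y : Submodule 𝕜 X, IsBlockSubspace e Y ∧ ¬ IsComplementedWith C Y)
    (C : ℝ) (N : ℕ) :
    ∃ s : Finset X, IsSuccessiveFamily e (s : Set X) ∧
      (∀ v ∈ s, ∀ i ∈ support e v, N < i) ∧ ¬ DiagComplemented e s C := by
  classical
  obtain ⟨K, hK⟩ := UnconditionalSchauderBasis.exists_norm_proj_le e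
  have hK0 : 0 ≤ K := (norm_nonneg _).trans (hK ∅)
  -- At most `N + 1` blocks meet `[0, N]`, each costing `K`; the absolute value and the final `1`
  -- ensure positivity.
  have hpos : 0 < |C| + (N + 1 : ℕ) * K + 1 := by positivity
  obtain ⟨_, ⟨y, hy, rfl⟩, hbad⟩ := H _ hpos
  have hfin : ∃ s : Finset X, ↑s ⊆ Set.range y ∧
      ¬ DiagComplemented e s (|C| + (N + 1 : ℕ) * K + 1) := by
    by_contra! h
    exact hbad (hy.isSuccessiveFamily.isDisjointFamily.isComplementedWith hpos.le h)
  obtain ⟨s, hs, hsbad⟩ := hfin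
  set p : X → Prop := fun v => ∀ i ∈ support e v, N < i
  have hsub : s.filter p ⊆ s := Finset.filter_subset _ _
  refine ⟨s.filter p, hy.isSuccessiveFamily.mono fun v hv => hs (hsub hv),
    fun v hv => (Finset.mem_filter.1 hv).2, fun hgood => hsbad ?_⟩
  have hcard : (s.filter (¬ p ·)).card ≤ N + 1 := by
    have : s.filter (¬ p ·) ⊆ (Finset.range (N + 1)).image y := fun v hv => by
      obtain ⟨hvs, hv⟩ := Finset.mem_filter.1 hv
      obtain ⟨n, rfl⟩ := hs hvs
      simp only [p, not_forall, not_lt] at hv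
      obtain ⟨i, hi, hiN⟩ := hv
      exact Finset.mem_image_of_mem _ (Finset.mem_range.2
        (Nat.lt_succ_of_le ((hy.le_of_mem_support hi).trans hiN)))
    simpa using (Finset.card_le_card this).trans Finset.card_image_le
  have hrest : DiagComplemented e (s.filter (¬ p ·)) ((s.filter (¬ p ·)).card * K) :=
    diagComplemented_card hK fun v hv =>
      hy.isSuccessiveFamily.ne_zero v (hs (Finset.mem_filter.1 hv).1)
  refine (hgood.union hrest).mono (Finset.filter_union_filter_not_eq p s).ge ?_
  have h1 : ((s.filter (¬ p ·)).card : ℝ) * K ≤ (N + 1 : ℕ) * K :=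
    mul_le_mul_of_nonneg_right (by exact_mod_cast hcard) hK0
  linarith [le_abs_self C]

/-- Finite successive families that can be found arbitrarily far along the basis can be
chosen such that their union is successive. -/
theorem exists_isSuccessiveFamily_iUnion {p : ℕ → Finset X → Prop}
    (H : ∀ j N : ℕ, ∃ s : Finset X, IsSuccessiveFamily e (s : Set X) ∧
      (∀ v ∈ s, ∀ i ∈ support e v, N < i) ∧ s.Nonempty ∧ p j s) :
    ∃ s : ℕ → Finset X, (∀ j, p j (s j)) ∧ IsSuccessiveFamily e (⋃ j, (s j : Set X)) ∧
      (⋃ j, (s j : Set X)).Infinite := by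
  choose G hG hGN hGne hGp using H
  -- The threshold moves past every index used by the family just chosen.
  let next : ℕ → ℕ → ℕ := fun j N => max N (((G j N).biUnion (suppFinset e)).sup id)
  let N : ℕ → ℕ := fun j => Nat.rec 0 next j
  have hN : ∀ j, N (j + 1) = next j (N j) := fun _ => rfl
  have hmono : Monotone N := monotone_nat_of_le_succ fun j => le_max_left _ _
  have hle : ∀ j, ∀ v ∈ G j (N j), ∀ i ∈ support e v, i ≤ N (j + 1) := fun j v hv i hi => by
    refine le_trans ?_ (le_max_right (N j) _)
    exact Finset.le_sup (f := id) (Finset.mem_biUnion.2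
      ⟨v, hv, (mem_suppFinset ((hG j (N j)).finite_support v hv)).2 hi⟩)
  have hlt : ∀ j k, j < k → ∀ v ∈ G j (N j), ∀ w ∈ G k (N k),
      ∀ i ∈ support e v, ∀ l ∈ support e w, i < l := fun j k hjk v hv w hw i hi l hl =>
    ((hle j v hv i hi).trans (hmono hjk)).trans_lt (hGN k (N k) w hw l hl)
  refine ⟨fun j => G j (N j), fun j => hGp j (N j), ⟨?_, ?_, ?_⟩, ?_⟩
  · intro v hv
    obtain ⟨j, hj⟩ := Set.mem_iUnion.1 hv
    exact (hG j (N j)).ne_zero v hj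
  · intro v hv
    obtain ⟨j, hj⟩ := Set.mem_iUnion.1 hv
    exact (hG j (N j)).finite_support v hj
  · intro v hv w hw hvw
    obtain ⟨j, hj⟩ := Set.mem_iUnion.1 hv
    obtain ⟨k, hk⟩ := Set.mem_iUnion.1 hw
    rcases lt_trichotomy j k with h | rfl | h
    · exact Or.inl (hlt j k h v hj w hk)
    · exact (hG j (N j)).lt_or_lt v hj w hk hvw
    · exact Or.inr fun i hi l hl => hlt k j h w hk v hj l hl i hi
  · choose v hv using fun j => hGne j (N j)
    have hne : ∀ j k, j < k → v j ≠ v k := fun j k h heq => by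
      obtain ⟨i, hi⟩ := support_nonempty (e := e) ((hG j (N j)).ne_zero (v j) (hv j))
      exact (hlt j k h (v j) (hv j) (v k) (hv k) i hi i (heq ▸ hi)).false
    refine Set.infinite_of_injective_forall_mem (f := v) (fun j k h => ?_)
      fun j => Set.mem_iUnion.2 ⟨j, hv j⟩
    by_contra hjk
    rcases lt_or_gt_of_ne hjk with h' | h'
    · exact hne j k h' h
    · exact hne k j h' h.symm

end

end BlockSubspaces

theorem mainTheorem6 {𝕜 : Type*} [RCLike 𝕜]
    {X : Type*} [NormedAddCommGroup X] [NormedSpace 𝕜 X] [CompleteSpace X]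
    (e : UnconditionalSchauderBasis ℕ 𝕜 X)
    (h : ∀ Y : Submodule 𝕜 X, BlockSubspaces.IsBlockSubspace e Y → Y.ClosedComplemented) :
    ∃ C : ℝ, 0 < C ∧ ∀ Y : Submodule 𝕜 X, BlockSubspaces.IsBlockSubspace e Y →
      BlockSubspaces.IsComplementedWith C Y := by
  by_contra! H
  obtain ⟨s, hs, hsucc, hinf⟩ := BlockSubspaces.exists_isSuccessiveFamily_iUnion (e := e)
    (p := fun j s => ¬ BlockSubspaces.DiagComplemented e s j) fun j N => by
      obtain ⟨s, h1, h2, h3⟩ := BlockSubspaces.exists_not_diagComplemented H j N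
      refine ⟨s, h1, h2, Finset.nonempty_iff_ne_empty.2 fun h0 => h3 ?_, h3⟩
      exact h0 ▸ BlockSubspaces.diagComplemented_empty j.cast_nonneg
  obtain ⟨z, hz, hrange⟩ := hsucc.exists_isBlockSequence hinf
  obtain ⟨K, hK⟩ := UnconditionalSchauderBasis.exists_norm_proj_le e
  obtain ⟨C, hC⟩ := hsucc.isDisjointFamily.exists_diagComplemented hK
    (h _ ⟨z, hz, by rw [hrange]⟩)
  obtain ⟨j, hj⟩ := exists_nat_ge C
  exact hs j ((hC (s j) (Set.subset_iUnion (fun j => (s j : Set X)) j)).mono subset_rfl hj)
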